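/- Let $d$ be a natural number, $\alpha>0$, and let $V:\mathbb R^d\to\mathbb R$ be measurable. Let $H(\alpha)=-\alpha\Delta+V$ be the Schrödinger operator on $L^2(\mathbb R^d)=L^2(\mathbb R^d;\mathbb C)$ defined through its quadratic form: put $Q=\{u\in H^1(\mathbb R^d):\int |V||u|^2\,dx<\infty\}$; then $u$ is in the domain of $H(\alpha)$ with $H(\alpha)u=w\in L^2(\mathbb R^d)$ if $u\in Q$ and $$\alpha\int_{\mathbb R^d}\nabla\overline v\cdot\nabla u\,dx+\int_{\mathbb R^d}V\,\overline v\,u\,dx=\int_{\mathbb R^d}\overline v\,w\,dx\qquad\text{for all }v\in Q .$$ **Theorem (Trace formula for $H(\alpha)$).** Suppose that $H(\alpha)$ has purely discrete spectrum (every point of its spectrum is isolated in the spectrum and is an eigenvalue of finite multiplicity), and let $(\phi_k)$ be an orthonormal basis of $L^2(\mathbb R^d)$ consisting of eigenfunctions, $H(\alpha)\phi_k=E_k\phi_k$ with $E_k\in\mathbb R$. Put $$T_{jk}=\Big|\int_{\mathbb R^d}\phi_j\nabla\overline{\phi}_k\,dx\Big|^2,$$ where $\nabla$ is the weak gradient and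 $|\cdot|$ the Euclidean norm on $\mathbb C^d$. Then $T_{jk}=T_{kj}$ for all $j,k$. Moreover, for every $C^1$ function $f:\mathbb R\to\mathbb R$ such that the sums below converge absolutely, that is, $$\sum_j|f(E_j)|<\infty\qquad\text{and}\qquad \sum_{j,k}T_{jk}\,\Big|\int_0^1f'(sE_j+(1-s)E_k)\,ds\Big|<\infty ,$$ one has $$d\sum_j f(E_j)+2\alpha\sum_j\sum_k T_{jk}\int_0^1 f'\big(sE_j+(1-s)E_k\big)\,ds=0 .$$ -/

import Mathlib

open scoped SchwartzMap LineDeriv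

noncomputable section

namespace Schrodinger

/-- The complex Hilbert space `L²(ℝᵈ)`. -/
abbrev L2 (d : ℕ) : Type :=
  MeasureTheory.Lp ℂ 2 (MeasureTheory.volume : MeasureTheory.Measure (EuclideanSpace ℝ (Fin d)))

/-- `v ∈ L²` is the weak partial derivative `∂u/∂xₐ` of `u ∈ L²`, in the sense of tempered
distributions. -/
def HasWeakPartial {d : ℕ} (a : Fin d) (u v : L2 d) : Prop :=
  ∂_{EuclideanSpace.single a (1 : ℝ)} (u : 𝓢'(EuclideanSpace ℝ (Fin d), ℂ)) =
    (v : 𝓢'(EuclideanSpace ℝ (Fin d), ℂ))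

open Classical in
/-- The weak partial derivative `∂u/∂xₐ` (the value `0` is used if there is none in `L²`). -/
def weakPartial {d : ℕ} (a : Fin d) (u : L2 d) : L2 d :=
  if h : ∃ v, HasWeakPartial a u v then h.choose else 0

theorem weakPartial_eq {d : ℕ} {a : Fin d} {u v : L2 d} (h : HasWeakPartial a u v) :
    weakPartial a u = v := by
  have hex : ∃ v, HasWeakPartial a u v := ⟨v, h⟩
  have h1 : HasWeakPartial a u (weakPartial a u) := by
    unfold weakPartial
    rw [dif_pos hex]
    exact hex.choose_spec
  have h2 := h1.symm.trans h
  have h3 := MeasureTheory.Lp.ker_toTemperedDistributionCLM_eq_bot (F := ℂ) (p := 2)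
    (μ := (MeasureTheory.volume : MeasureTheory.Measure (EuclideanSpace ℝ (Fin d))))
  exact LinearMap.ker_eq_bot.mp h3 h2

/-- Membership in the Sobolev space `H¹(ℝᵈ)`. -/
def MemH1 {d : ℕ} (u : L2 d) : Prop := ∀ a, ∃ v, HasWeakPartial a u v

/-- The form domain `{u ∈ H¹(ℝᵈ) : ∫ |V| |u|² < ∞}`. -/
def MemFormDomain {d : ℕ} (V : EuclideanSpace ℝ (Fin d) → ℝ) (u : L2 d) : Prop :=
  MemH1 u ∧ MeasureTheory.Integrable (fun x => |V x| * ‖u x‖ ^ 2) MeasureTheory.volume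

/-- The quadratic (sesquilinear) form `α ∫ ∇v̄ · ∇u + ∫ V v̄ u` of `-αΔ + V`. -/
def form {d : ℕ} (α : ℝ) (V : EuclideanSpace ℝ (Fin d) → ℝ) (v u : L2 d) : ℂ :=
  (α : ℂ) * ∑ a, inner ℂ (weakPartial a v) (weakPartial a u) +
    ∫ x, (V x : ℂ) * (star (v x) * u x)

/-- The graph of the Schrödinger operator `H(α) = -αΔ + V` on `L²(ℝᵈ)`, the operator associated
with its quadratic form: `u` is in the domain of `H(α)` and `H(α) u = w`. -/
def HamiltonianMaps {d : ℕ} (α : ℝ) (V : EuclideanSpace ℝ (Fin d) → ℝ) (u w : L2 d) : Prop :=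
  MemFormDomain V u ∧ ∀ v, MemFormDomain V v → form α V v u = inner ℂ v w

/-- The resolvent set: those `z` for which `H(α) - z` has an everywhere defined bounded
inverse `R`, i.e. `R g = u` if and only if `u ∈ dom H(α)` and `H(α) u - z u = g`. -/
def resolventSet {d : ℕ} (α : ℝ) (V : EuclideanSpace ℝ (Fin d) → ℝ) : Set ℂ :=
  {z | ∃ R : L2 d →L[ℂ] L2 d, ∀ u g, R g = u ↔ HamiltonianMaps α V u (g + z • u)}

/-- The spectrum of `H(α)`. -/
def spectrum {d : ℕ} (α : ℝ) (V : EuclideanSpace ℝ (Fin d) → ℝ) : Set ℂ :=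
  (resolventSet α V)ᶜ

/-- Purely discrete spectrum: each point of the spectrum is isolated in the spectrum, and is an
eigenvalue of finite multiplicity. -/
def HasPurelyDiscreteSpectrum {d : ℕ} (α : ℝ) (V : EuclideanSpace ℝ (Fin d) → ℝ) : Prop :=
  ∀ z ∈ spectrum α V,
    (∃ ε > 0, ∀ w ∈ spectrum α V, w ≠ z → ε ≤ dist w z) ∧
    (∃ u, u ≠ 0 ∧ HamiltonianMaps α V u (z • u)) ∧
    ∃ S : Submodule ℂ (L2 d), FiniteDimensional ℂ S ∧ ∀ u, HamiltonianMaps α V u (z • u) → u ∈ S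

/-- The kinetic energy matrix element `|∫ u ∇v̄ dx|²`, the squared Euclidean norm of a vector
in `ℂᵈ`. -/
def kineticElement {d : ℕ} (u v : L2 d) : ℝ :=
  ∑ a, ‖∫ x, u x * star (weakPartial a v x)‖ ^ 2

end Schrodinger

end

/-!
The proof multiplies eigenfunctions by plane waves `Uₛ = exp (i s xₐ)` instead of by the coordinate
`xₐ`, so that no decay of the eigenfunctions is needed. `Uₛ` is unitary, preserves the form domain,
and satisfies `H Uₛ - Uₛ H = Uₛ (-2iαs ∂ₐ + αs²)` (`form_modulate`). For eigenfunctions this reads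
`(E_k - E_j) ⟨φ_k, Uₛ φ_j⟩ = s ⟨φ_k, yₛ⟩` with `yₛ → -2iα ∂ₐφ_j` as `s → 0`
(`sub_mul_inner_modulate`). In particular `⟨φ_k, ∂ₐφ_j⟩ = 0` whenever `E_k = E_j`, and Parseval's
identity for `⟨Uₛ φ_j, yₛ⟩ = αs` gives `∑ₖ |⟨φ_k, yₛ⟩|² / (E_k - E_j) = α` for `s ≠ 0`. Since `E_j` is
isolated in the spectrum, the left side is continuous in `yₛ`, and `s → 0` yields the
Thomas–Reiche–Kuhn sum rule `∑ₖ |⟨φ_k, ∂ₐφ_j⟩|² / (E_k - E_j) = 1 / (4α)`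
(`hasSum_norm_inner_weakPartial_sq_div`).

Write `T_jk` for `kineticElement (φ j) (φ k)`. The integral of `f'` in the trace formula is the
difference quotient of `f` between `E_j` and `E_k`. If only finitely many of the numbers
`h_j = f (E_j)` are non-zero, then the double sum splits into the sum rules weighted by `h_j`
(`hasSum_mul_slope_of_finite_support`). In general this splitting would not converge, so `h` is
replaced by its soft threshold at level `c > 0`. This has finite support because `∑ |h_j| < ∞`, and
as thresholding is `1`-Lipschitz, its difference quotients are dominated by those of `h`. Dominated
convergence as `c → 0` then gives the formula (`tsum_mul_slope_of_sum_rule`).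
-/

namespace Schrodinger

open scoped FourierTransform ContDiff ENNReal
open MeasureTheory Filter Topology

variable {d : ℕ}

/-! ### Modulation by plane waves -/

theorem hasTemperateGrowth_cexp_mul_I :
    (fun t : ℝ => Complex.exp (t * Complex.I)).HasTemperateGrowth := by
  have h : ∀ n : ℕ, iteratedDeriv n (fun t : ℝ => Complex.exp (t * Complex.I)) =
      fun t : ℝ => Complex.I ^ n * Complex.exp (t * Complex.I) := by
    intro n
    induction n with
    | zero => simp
    | succ n ih =>
      rw [iteratedDeriv_succ, ih]
      funext t
      have h1 : HasDerivAt (fun t : ℝ => (t : ℂ) * Complex.I) Complex.I t := by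
        simpa using (Complex.ofRealCLM.hasDerivAt (x := t)).mul_const Complex.I
      rw [(h1.cexp.const_mul (Complex.I ^ n)).deriv]
      ring
  refine ⟨(Complex.ofRealCLM.contDiff.mul contDiff_const).cexp, fun n => ⟨0, 1, fun t => ?_⟩⟩
  rw [norm_iteratedFDeriv_eq_norm_iteratedDeriv, h]
  simp [Complex.norm_exp_ofReal_mul_I]

/-- The plane wave `x ↦ exp (i s xₐ)`. -/
noncomputable def planeWave (a : Fin d) (s : ℝ) (x : EuclideanSpace ℝ (Fin d)) : ℂ :=
  Complex.exp ((s * x a : ℝ) * Complex.I)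

theorem norm_planeWave (a : Fin d) (s : ℝ) (x : EuclideanSpace ℝ (Fin d)) :
    ‖planeWave a s x‖ = 1 :=
  Complex.norm_exp_ofReal_mul_I _

theorem star_planeWave (a : Fin d) (s : ℝ) (x : EuclideanSpace ℝ (Fin d)) :
    star (planeWave a s x) = planeWave a (-s) x := by
  simp [planeWave, ← Complex.exp_conj]

theorem continuous_planeWave (a : Fin d) (s : ℝ) : Continuous (planeWave a s) := by
  unfold planeWave
  fun_prop

theorem hasTemperateGrowth_planeWave (a : Fin d) (s : ℝ) :
    (planeWave a s).HasTemperateGrowth :=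
  hasTemperateGrowth_cexp_mul_I.comp (s • EuclideanSpace.proj (𝕜 := ℝ) a).hasTemperateGrowth

theorem memLp_planeWave (a : Fin d) (s : ℝ) :
    MemLp (planeWave a s) ∞ (volume : Measure (EuclideanSpace ℝ (Fin d))) :=
  memLp_top_of_bound (continuous_planeWave a s).aestronglyMeasurable 1
    (.of_forall fun x => (norm_planeWave a s x).le)

/-- Multiplication of a square integrable function by the plane wave `exp (i s xₐ)`. -/
noncomputable def modulate (a : Fin d) (s : ℝ) (u : L2 d) : L2 d :=
  ((memLp_planeWave a s).toLp (planeWave a s)) • u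

theorem coeFn_modulate (a : Fin d) (s : ℝ) (u : L2 d) :
    ∀ᵐ x, modulate a s u x = planeWave a s x * u x := by
  filter_upwards [Lp.coeFn_lpSMul (r := 2) ((memLp_planeWave a s).toLp (planeWave a s)) u,
    (memLp_planeWave a s).coeFn_toLp] with x h1 h2
  rw [modulate, h1, Pi.smul_apply', h2, smul_eq_mul]

theorem inner_modulate_left (a : Fin d) (s : ℝ) (u v : L2 d) :
    inner ℂ (modulate a (-s) v) u = inner ℂ v (modulate a s u) := by
  rw [L2.inner_def, L2.inner_def]
  refine integral_congr_ae ?_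
  filter_upwards [coeFn_modulate a (-s) v, coeFn_modulate a s u] with x h1 h2
  have h3 : (starRingEnd ℂ) (planeWave a (-s) x) = planeWave a s x := by
    simpa using star_planeWave a (-s) x
  simp only [h1, h2, RCLike.inner_apply, map_mul, h3]
  ring

theorem inner_modulate_modulate (a : Fin d) (s : ℝ) (u v : L2 d) :
    inner ℂ (modulate a s v) (modulate a s u) = inner ℂ v u := by
  rw [L2.inner_def, L2.inner_def]
  refine integral_congr_ae ?_
  filter_upwards [coeFn_modulate a s v, coeFn_modulate a s u] with x h1 h2
  have h3 : planeWave a s x * (starRingEnd ℂ) (planeWave a s x) = 1 := by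
    rw [Complex.mul_conj, Complex.normSq_eq_norm_sq, norm_planeWave]; simp
  simp only [h1, h2, RCLike.inner_apply, map_mul]
  linear_combination (u x * (starRingEnd ℂ) (v x)) * h3

/-- Strong continuity of `s ↦ Uₛ` at `0`, by dominated convergence in
`‖Uₛ u - u‖² = ∫ |exp (i s xₐ) - 1|² |u|²`. -/
theorem tendsto_modulate (a : Fin d) (u : L2 d) :
    Tendsto (fun s => modulate a s u) (𝓝 0) (𝓝 u) := by
  have hsq : ∀ s, ‖modulate a s u - u‖ ^ 2 = ∫ x, ‖planeWave a s x - 1‖ ^ 2 * ‖u x‖ ^ 2 := by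
    intro s
    have h := congrArg Complex.re (inner_self_eq_norm_sq_to_K (𝕜 := ℂ) (modulate a s u - u))
    have h2 : (((‖modulate a s u - u‖ : ℝ) : ℂ) ^ 2).re = ‖modulate a s u - u‖ ^ 2 := by
      rw [← Complex.ofReal_pow, Complex.ofReal_re]
    rw [← h2]
    refine h.symm.trans ?_
    rw [L2.inner_def, ← Complex.ofReal_re (∫ x, ‖planeWave a s x - 1‖ ^ 2 * ‖u x‖ ^ 2),
      ← integral_complex_ofReal]
    congr 1
    refine integral_congr_ae ?_
    filter_upwards [coeFn_modulate a s u, Lp.coeFn_sub (modulate a s u) u] with x h1 h2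
    rw [inner_self_eq_norm_sq_to_K, h2, Pi.sub_apply, h1,
      show planeWave a s x * u x - u x = (planeWave a s x - 1) * u x by ring, norm_mul, ← mul_pow,
      Complex.ofReal_pow]
    rfl
  have hint : Integrable (fun x => ‖u x‖ ^ 2) volume := (Lp.memLp u).integrable_norm_pow (by simp)
  have hlim : Tendsto (fun s => ‖modulate a s u - u‖ ^ 2) (𝓝 0) (𝓝 0) := by
    simp only [hsq]
    rw [← integral_zero (EuclideanSpace ℝ (Fin d)) ℝ (μ := volume)]
    refine tendsto_integral_filter_of_dominated_convergence (fun x => 4 * ‖u x‖ ^ 2)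
      (.of_forall fun s => ?_) (.of_forall fun s => .of_forall fun x => ?_)
      (hint.const_mul 4) (.of_forall fun x => ?_)
    · exact (((continuous_planeWave a s).sub continuous_const).norm.pow 2).aestronglyMeasurable.mul
        hint.aestronglyMeasurable
    · have h1 : ‖planeWave a s x - 1‖ ≤ 2 := by
        refine (norm_sub_le _ _).trans ?_
        rw [norm_planeWave, norm_one]; norm_num
      rw [Real.norm_of_nonneg (by positivity)]
      gcongr
      nlinarith [norm_nonneg (planeWave a s x - 1)]
    · have h1 : Continuous fun s => ‖planeWave a s x - 1‖ ^ 2 * ‖u x‖ ^ 2 := by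
        unfold planeWave; fun_prop
      simpa [planeWave] using h1.tendsto 0
  rw [tendsto_iff_norm_sub_tendsto_zero]
  simpa using hlim.sqrt

/-! ### Weak derivatives -/

theorem hasWeakPartial_weakPartial {a : Fin d} {u : L2 d} (h : MemH1 u) :
    HasWeakPartial a u (weakPartial a u) := by
  obtain ⟨v, hv⟩ := h a
  rwa [weakPartial_eq hv]

theorem lineDerivOp_planeWave_smul (a b : Fin d) (s : ℝ) (ψ : 𝓢(EuclideanSpace ℝ (Fin d), ℂ)) :
    ∂_{EuclideanSpace.single b (1 : ℝ)} (SchwartzMap.smulLeftCLM ℂ (planeWave a s) ψ) =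
      SchwartzMap.smulLeftCLM ℂ (planeWave a s) (∂_{EuclideanSpace.single b (1 : ℝ)} ψ) +
        (if a = b then Complex.I * s else 0) • SchwartzMap.smulLeftCLM ℂ (planeWave a s) ψ := by
  have hg := hasTemperateGrowth_planeWave a s
  ext x
  have hcoe : ⇑(SchwartzMap.smulLeftCLM ℂ (planeWave a s) ψ) = fun y => planeWave a s y * ψ y := by
    funext y
    simp [SchwartzMap.smulLeftCLM_apply_apply hg]
  have hlin : HasLineDerivAt ℝ (fun y : EuclideanSpace ℝ (Fin d) => ((s * y a : ℝ) : ℂ) * Complex.I)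
      ((if a = b then Complex.I * s else 0)) x (EuclideanSpace.single b 1) := by
    have h1 : HasDerivAt (fun t : ℝ => (((s * x a : ℝ) : ℂ) + (t : ℂ) *
        ((if a = b then s else 0 : ℝ) : ℂ)) * Complex.I)
        ((if a = b then Complex.I * s else 0)) 0 := by
      have := (((Complex.ofRealCLM.hasDerivAt (x := (0:ℝ))).mul_const
        (((if a = b then s else 0 : ℝ) : ℂ))).const_add ((s * x a : ℝ) : ℂ)).mul_const Complex.I
      refine this.congr_deriv ?_
      split_ifs <;> simp [mul_comm]
    refine (congrArg (fun F : ℝ → ℂ => HasDerivAt F _ 0) ?_).mpr h1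
    funext t
    by_cases hab : a = b
    · subst hab
      simp
      ring
    · simp [hab]
  have hpw : HasLineDerivAt ℝ (planeWave a s)
      (planeWave a s x * (if a = b then Complex.I * s else 0)) x (EuclideanSpace.single b 1) := by
    have := HasDerivAt.cexp hlin
    refine this.congr_deriv ?_
    simp [planeWave]
  have hψ : HasLineDerivAt ℝ ψ (lineDeriv ℝ ψ x (EuclideanSpace.single b 1)) x
      (EuclideanSpace.single b 1) :=
    (ψ.differentiableAt.lineDifferentiableAt).hasLineDerivAt
  have hprod : HasLineDerivAt ℝ (fun y => planeWave a s y * ψ y)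
      (planeWave a s x * (if a = b then Complex.I * s else 0) * ψ x +
        planeWave a s x * lineDeriv ℝ ψ x (EuclideanSpace.single b 1)) x
      (EuclideanSpace.single b 1) := by
    have := HasDerivAt.mul hpw hψ
    refine this.congr_deriv ?_
    simp
  rw [SchwartzMap.lineDerivOp_apply, hcoe, hprod.lineDeriv]
  simp only [_root_.add_apply, _root_.smul_apply, SchwartzMap.smulLeftCLM_apply_apply hg,
    SchwartzMap.lineDerivOp_apply, smul_eq_mul]
  ring

theorem coe_modulate (a : Fin d) (s : ℝ) (u : L2 d) :
    ((modulate a s u : L2 d) : 𝓢'(EuclideanSpace ℝ (Fin d), ℂ)) =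
      TemperedDistribution.smulLeftCLM ℂ (planeWave a s) (u : 𝓢'(EuclideanSpace ℝ (Fin d), ℂ)) :=
  Lp.toTemperedDistribution_smul_eq (hasTemperateGrowth_planeWave a s) (memLp_planeWave a s) u

theorem coe_add (u v : L2 d) : ((u + v : L2 d) : 𝓢'(EuclideanSpace ℝ (Fin d), ℂ)) =
    (u : 𝓢'(EuclideanSpace ℝ (Fin d), ℂ)) + (v : 𝓢'(EuclideanSpace ℝ (Fin d), ℂ)) :=
  (Lp.toTemperedDistributionCLM ℂ volume 2).map_add u v

theorem coe_smul (c : ℂ) (u : L2 d) : ((c • u : L2 d) : 𝓢'(EuclideanSpace ℝ (Fin d), ℂ)) =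
    c • (u : 𝓢'(EuclideanSpace ℝ (Fin d), ℂ)) :=
  (Lp.toTemperedDistributionCLM ℂ volume 2).map_smul c u

/-- The product rule `∂_b (Uₛ u) = Uₛ (∂_b u) + δ_ab i s Uₛ u`. -/
theorem HasWeakPartial.modulate {b : Fin d} {u u' : L2 d} (h : HasWeakPartial b u u')
    (a : Fin d) (s : ℝ) :
    HasWeakPartial b (modulate a s u)
      (modulate a s u' + (if a = b then Complex.I * s else 0 : ℂ) • modulate a s u) := by
  unfold HasWeakPartial at h ⊢
  rw [coe_add, coe_smul, coe_modulate, coe_modulate, ← h]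
  ext ψ
  have h1 := lineDerivOp_planeWave_smul a b s ψ
  change (u : 𝓢'(EuclideanSpace ℝ (Fin d), ℂ)) (SchwartzMap.smulLeftCLM ℂ (planeWave a s)
      (-∂_{EuclideanSpace.single b (1 : ℝ)} ψ)) =
    (u : 𝓢'(EuclideanSpace ℝ (Fin d), ℂ)) (-∂_{EuclideanSpace.single b (1 : ℝ)}
      (SchwartzMap.smulLeftCLM ℂ (planeWave a s) ψ)) +
    (if a = b then Complex.I * s else 0 : ℂ) •
      (u : 𝓢'(EuclideanSpace ℝ (Fin d), ℂ)) (SchwartzMap.smulLeftCLM ℂ (planeWave a s) ψ)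
  rw [h1, map_neg, map_neg, map_neg, map_add, map_smul]
  abel

/-- On the Fourier side `∂ₐ` is multiplication by `2πi ξₐ`. This product is a priori only locally
integrable, so the two sides are compared by testing against smooth functions of compact support. -/
theorem HasWeakPartial.fourier_ae_eq {a : Fin d} {u v : L2 d} (h : HasWeakPartial a u v) :
    ∀ᵐ ξ, (𝓕 v : L2 d) ξ = (2 * Real.pi * Complex.I * (ξ a : ℂ)) * (𝓕 u : L2 d) ξ := by
  have h1 : ((𝓕 v : L2 d) : 𝓢'(EuclideanSpace ℝ (Fin d), ℂ)) = (2 * Real.pi * Complex.I) •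
      TemperedDistribution.smulLeftCLM ℂ
        (fun x : EuclideanSpace ℝ (Fin d) => ((inner ℝ x (EuclideanSpace.single a (1 : ℝ)) : ℝ) : ℂ))
        ((𝓕 u : L2 d) : 𝓢'(EuclideanSpace ℝ (Fin d), ℂ)) := by
    rw [← Lp.fourier_toTemperedDistribution_eq, ← Lp.fourier_toTemperedDistribution_eq, ← h]
    exact TemperedDistribution.fourier_lineDerivOp_eq _ _
  have hg : (fun x : EuclideanSpace ℝ (Fin d) =>
      ((inner ℝ x (EuclideanSpace.single a (1 : ℝ)) : ℝ) : ℂ)).HasTemperateGrowth := by fun_prop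
  have hcont : Continuous fun ξ : EuclideanSpace ℝ (Fin d) =>
      (2 * Real.pi * Complex.I * (ξ a : ℂ)) := by fun_prop
  have hloc : LocallyIntegrable (𝓕 u : L2 d) volume :=
    (Lp.memLp _).locallyIntegrable (by norm_num)
  refine ae_eq_of_integral_contDiff_smul_eq ((Lp.memLp _).locallyIntegrable (by norm_num)) ?_ ?_
  · rw [← locallyIntegrableOn_univ] at hloc ⊢
    exact hloc.continuousOn_mul hcont.continuousOn isOpen_univ.isLocallyClosed
  · intro g g_smooth g_cpt
    have hg₁ : HasCompactSupport (Complex.ofRealCLM ∘ g) := g_cpt.comp_left rfl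
    have hg₂ : ContDiff ℝ ∞ (Complex.ofRealCLM ∘ g) := by fun_prop
    have h2 := congrArg (fun T : 𝓢'(EuclideanSpace ℝ (Fin d), ℂ) =>
      T (hg₁.toSchwartzMap hg₂)) h1
    have h3 : (∫ x, (hg₁.toSchwartzMap hg₂) x • (𝓕 v : L2 d) x) =
        (2 * Real.pi * Complex.I) • ∫ x, SchwartzMap.smulLeftCLM ℂ
          (fun x : EuclideanSpace ℝ (Fin d) =>
            ((inner ℝ x (EuclideanSpace.single a (1 : ℝ)) : ℝ) : ℂ))
          (hg₁.toSchwartzMap hg₂) x • (𝓕 u : L2 d) x := by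
      rw [← Lp.toTemperedDistribution_apply, ← Lp.toTemperedDistribution_apply]
      exact h2
    rw [← integral_smul] at h3
    simp only [SchwartzMap.smulLeftCLM_apply_apply hg] at h3
    convert h3 using 1
    · simp
    · refine integral_congr_ae (.of_forall fun x => ?_)
      simp [EuclideanSpace.inner_single_right]
      ring

/-- Integration by parts in `H¹`, read off on the Fourier side, where `∂ₐ` is multiplication by a
purely imaginary function. -/
theorem HasWeakPartial.inner_left_eq_neg {a : Fin d} {u u' v v' : L2 d}
    (hu : HasWeakPartial a u u') (hv : HasWeakPartial a v v') :
    inner ℂ v' u = -inner ℂ v u' := by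
  rw [← Lp.inner_fourier_eq v' u, ← Lp.inner_fourier_eq v u', L2.inner_def, L2.inner_def,
    ← integral_neg]
  refine integral_congr_ae ?_
  filter_upwards [hu.fourier_ae_eq, hv.fourier_ae_eq] with x h1 h2
  simp only [h1, h2, RCLike.inner_apply, map_mul, Complex.conj_I, Complex.conj_ofReal, map_ofNat]
  ring

/-! ### The commutator of the form with a modulation -/

theorem MemFormDomain.modulate {V : EuclideanSpace ℝ (Fin d) → ℝ} {u : L2 d}
    (hu : MemFormDomain V u) (a : Fin d) (s : ℝ) : MemFormDomain V (modulate a s u) := by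
  refine ⟨fun b => ⟨_, (hasWeakPartial_weakPartial (hu.1)).modulate a s⟩, hu.2.congr ?_⟩
  filter_upwards [coeFn_modulate a s u] with x hx
  rw [hx, norm_mul, norm_planeWave, one_mul]

theorem star_form (α : ℝ) (V : EuclideanSpace ℝ (Fin d) → ℝ) (u v : L2 d) :
    (starRingEnd ℂ) (form α V v u) = form α V u v := by
  unfold form
  rw [map_add, map_mul, Complex.conj_ofReal, map_sum, ← integral_conj]
  congr 1
  · simp
  · congr 1
    funext x
    simp only [map_mul, Complex.conj_ofReal, RCLike.star_def, Complex.conj_conj]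
    ring

/-- Conjugating the form by a modulation adds the first and zeroth order terms
`-2iαs ∂ₐ + αs²` to the operator. -/
theorem form_modulate (α : ℝ) {V : EuclideanSpace ℝ (Fin d) → ℝ} {u v : L2 d}
    (hu : MemH1 u) (hv : MemH1 v) (a : Fin d) (s : ℝ) :
    form α V v (modulate a s u) = form α V (modulate a (-s) v) u +
      inner ℂ v ((s : ℂ) • ((-(2 * Complex.I * α)) • modulate a s (weakPartial a u) +
        ((α * s : ℝ) : ℂ) • modulate a s u)) := by
  have hpot : (∫ x, (V x : ℂ) * (star (v x) * modulate a s u x)) =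
      ∫ x, (V x : ℂ) * (star (modulate a (-s) v x) * u x) := by
    refine integral_congr_ae ?_
    filter_upwards [coeFn_modulate a s u, coeFn_modulate a (-s) v] with x h1 h2
    rw [h1, h2, star_mul', star_planeWave, neg_neg]
    ring
  have hsum : ∀ b, inner ℂ (weakPartial b v) (weakPartial b (modulate a s u)) =
      inner ℂ (weakPartial b (modulate a (-s) v)) (weakPartial b u) +
      if a = b then -(2 * Complex.I * s * inner ℂ v (modulate a s (weakPartial a u))) +
        (s : ℂ) ^ 2 * inner ℂ v (modulate a s u) else 0 := by
    intro b
    have h1 := (hasWeakPartial_weakPartial (a := b) hu).modulate a s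
    rw [weakPartial_eq h1,
      weakPartial_eq ((hasWeakPartial_weakPartial (a := b) hv).modulate a (-s))]
    split_ifs with hab
    · subst hab
      have h2 := h1.inner_left_eq_neg (hasWeakPartial_weakPartial (a := a) hv)
      simp only [if_true, inner_add_right, inner_smul_right] at h2
      simp only [inner_add_right, inner_add_left, inner_smul_right, inner_smul_left,
        inner_modulate_left, h2, map_mul, Complex.conj_I, Complex.conj_ofReal]
      push_cast
      linear_combination (-(s : ℂ) ^ 2 * inner ℂ v (modulate a s u)) * Complex.I_sq
    · simp [inner_modulate_left]
  unfold form
  rw [hpot, Finset.sum_congr rfl fun b _ => hsum b, Finset.sum_add_distrib]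
  simp only [Finset.sum_ite_eq, Finset.mem_univ, if_true, inner_smul_right, inner_add_right]
  push_cast
  ring

/-! ### Bounded diagonal quadratic forms -/

section Basis

variable {ι : Type*} {H : Type*} [NormedAddCommGroup H] [InnerProductSpace ℂ H]

theorem sum_norm_inner_mul_norm_inner_le {φ : ι → H} (hφ : Orthonormal ℂ φ) (x y : H)
    (F : Finset ι) :
    ∑ k ∈ F, ‖(inner ℂ (φ k) x : ℂ)‖ * ‖(inner ℂ (φ k) y : ℂ)‖ ≤ ‖x‖ * ‖y‖ := by
  refine (Real.sum_mul_le_sqrt_mul_sqrt _ _ _).trans ?_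
  gcongr <;> exact Real.sqrt_le_iff.mpr ⟨norm_nonneg _, hφ.sum_inner_products_le _⟩

theorem summable_mul_norm_inner_mul_norm_inner {φ : ι → H} (hφ : Orthonormal ℂ φ) {c : ι → ℝ}
    {C : ℝ} (hc : ∀ k, |c k| ≤ C) (x y : H) :
    Summable fun k => |c k| * (‖(inner ℂ (φ k) x : ℂ)‖ * ‖(inner ℂ (φ k) y : ℂ)‖) := by
  have h : Summable fun k => ‖(inner ℂ (φ k) x : ℂ)‖ * ‖(inner ℂ (φ k) y : ℂ)‖ :=
    summable_of_sum_le (fun k => by positivity) (sum_norm_inner_mul_norm_inner_le hφ x y)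
  exact (h.mul_left C).of_nonneg_of_le (fun k => by positivity)
    fun k => mul_le_mul_of_nonneg_right (hc k) (by positivity)

theorem summable_mul_norm_inner_sq {φ : ι → H} (hφ : Orthonormal ℂ φ) {c : ι → ℝ}
    {C : ℝ} (hc : ∀ k, |c k| ≤ C) (y : H) :
    Summable fun k => c k * ‖(inner ℂ (φ k) y : ℂ)‖ ^ 2 := by
  refine (summable_mul_norm_inner_mul_norm_inner hφ hc y y).of_norm_bounded fun k => ?_
  rw [norm_mul, Real.norm_eq_abs, Real.norm_of_nonneg (by positivity), sq]

/-- The quadratic form of a bounded diagonal operator is continuous. -/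
theorem continuous_tsum_mul_norm_inner_sq {φ : ι → H} (hφ : Orthonormal ℂ φ) {c : ι → ℝ}
    {C : ℝ} (hc : ∀ k, |c k| ≤ C) :
    Continuous fun y : H => ∑' k, c k * ‖(inner ℂ (φ k) y : ℂ)‖ ^ 2 := by
  have hbound : ∀ y z : H, ‖∑' k, c k * ‖(inner ℂ (φ k) y : ℂ)‖ ^ 2 -
      ∑' k, c k * ‖(inner ℂ (φ k) z : ℂ)‖ ^ 2‖ ≤ |C| * (‖y - z‖ * ‖y + z‖) := by
    intro y z
    have hs := summable_mul_norm_inner_mul_norm_inner hφ hc (y - z) (y + z)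
    rw [← (summable_mul_norm_inner_sq hφ hc y).tsum_sub (summable_mul_norm_inner_sq hφ hc z)]
    refine (tsum_of_norm_bounded hs.hasSum fun k => ?_).trans
      (Real.tsum_le_of_sum_le (fun k => by positivity) fun F => ?_)
    · rw [← mul_sub, norm_mul, Real.norm_eq_abs, Real.norm_eq_abs, inner_sub_right,
        inner_add_right]
      gcongr
      -- `|p|² - |q|²` is the real part of `(p - q) * conj (p + q)`
      set p : ℂ := inner ℂ (φ k) y
      set q : ℂ := inner ℂ (φ k) z
      rw [← norm_mul]
      refine le_trans (le_of_eq ?_) (Complex.abs_re_le_norm ((p - q) * (starRingEnd ℂ) (p + q))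
        |>.trans (by rw [norm_mul, norm_mul, Complex.norm_conj]))
      congr 1
      rw [← Complex.normSq_eq_norm_sq, ← Complex.normSq_eq_norm_sq, Complex.normSq_apply,
        Complex.normSq_apply]
      simp
      ring
    · calc _ ≤ ∑ k ∈ F, |C| * (‖(inner ℂ (φ k) (y - z) : ℂ)‖ * ‖(inner ℂ (φ k) (y + z) : ℂ)‖) := by
            exact Finset.sum_le_sum fun k _ =>
              mul_le_mul_of_nonneg_right ((hc k).trans (le_abs_self C)) (by positivity)
        _ ≤ _ := by
            rw [← Finset.mul_sum]
            gcongr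
            exact sum_norm_inner_mul_norm_inner_le hφ _ _ F
  refine continuous_iff_continuousAt.mpr fun z => tendsto_iff_norm_sub_tendsto_zero.mpr ?_
  refine squeeze_zero (fun y => norm_nonneg _) (fun y => hbound y z) ?_
  have hcont : Continuous fun y : H => |C| * (‖y - z‖ * ‖y + z‖) := by fun_prop
  simpa using hcont.tendsto z

end Basis

/-! ### The sum rule -/

section SumRule

variable {α : ℝ} {V : EuclideanSpace ℝ (Fin d) → ℝ}

/-- The vector `yₛ` for which `(H(α) - E) (exp (i s xₐ) u) = s yₛ` when `H(α) u = E u`. -/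
noncomputable def modulationDefect (α : ℝ) (a : Fin d) (s : ℝ) (u : L2 d) : L2 d :=
  (-(2 * Complex.I * α)) • modulate a s (weakPartial a u) + ((α * s : ℝ) : ℂ) • modulate a s u

theorem tendsto_modulationDefect (α : ℝ) (a : Fin d) (u : L2 d) :
    Tendsto (fun s => modulationDefect α a s u) (𝓝[≠] 0)
      (𝓝 ((-(2 * Complex.I * α)) • weakPartial a u)) := by
  have h1 : Tendsto (fun s : ℝ => ((α * s : ℝ) : ℂ)) (𝓝 0) (𝓝 0) := by
    have : Continuous fun s : ℝ => ((α * s : ℝ) : ℂ) := by fun_prop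
    simpa using this.tendsto 0
  have h2 := ((tendsto_modulate a (weakPartial a u)).const_smul (-(2 * Complex.I * (α : ℂ)))).add
    (h1.smul (tendsto_modulate a u))
  rw [zero_smul, add_zero] at h2
  exact h2.mono_left nhdsWithin_le_nhds

/-- Matrix elements of the commutator of `H(α)` with `exp (i s xₐ)` between eigenfunctions. -/
theorem sub_mul_inner_modulate {u v : L2 d} {e e' : ℝ} (hu : HamiltonianMaps α V u ((e : ℂ) • u))
    (hv : HamiltonianMaps α V v ((e' : ℂ) • v)) (a : Fin d) (s : ℝ) :
    ((e' - e : ℝ) : ℂ) * inner ℂ v (modulate a s u) = s * inner ℂ v (modulationDefect α a s u) := by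
  have h1 := form_modulate α (V := V) hu.1.1 hv.1.1 a s
  rw [hu.2 _ (hv.1.modulate a (-s)), ← star_form, hv.2 _ (hu.1.modulate a s)] at h1
  simp only [inner_smul_right, map_mul, Complex.conj_ofReal, inner_conj_symm,
    inner_modulate_left] at h1
  rw [modulationDefect]
  push_cast at h1 ⊢
  linear_combination h1

/-- `∂ₐ` has no matrix elements between eigenfunctions for the same eigenvalue: dividing the
commutator identity by `s` and letting `s → 0` leaves `0 = -2iα ⟨v, ∂ₐu⟩`. -/
theorem inner_weakPartial_eq_zero (hα : 0 < α) {u v : L2 d} {e : ℝ}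
    (hu : HamiltonianMaps α V u ((e : ℂ) • u))
    (hv : HamiltonianMaps α V v ((e : ℂ) • v)) (a : Fin d) :
    (inner ℂ v (weakPartial a u) : ℂ) = 0 := by
  have h1 : Tendsto (fun s => (inner ℂ v (modulationDefect α a s u) : ℂ)) (𝓝[≠] 0)
      (𝓝 (inner ℂ v ((-(2 * Complex.I * α)) • weakPartial a u))) :=
    tendsto_const_nhds.inner (tendsto_modulationDefect α a u)
  have h2 : ∀ᶠ s : ℝ in 𝓝[≠] 0, (inner ℂ v (modulationDefect α a s u) : ℂ) = 0 := by
    filter_upwards [self_mem_nhdsWithin] with s hs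
    have := sub_mul_inner_modulate hu hv a s
    simpa [show s ≠ 0 from hs] using this
  have h3 := tendsto_nhds_unique_of_eventuallyEq h1 tendsto_const_nhds h2
  simpa [inner_smul_right, hα.ne'] using h3

/-- The Thomas–Reiche–Kuhn sum rule for `-αΔ + V`. The levels `E k = E j` contribute nothing, both
because the matrix element vanishes and because `0⁻¹ = 0`. -/
theorem hasSum_norm_inner_weakPartial_sq_div {ι : Type*} (hα : 0 < α)
    (φ : HilbertBasis ι ℂ (L2 d)) {E : ι → ℝ}
    (hE : ∀ k, HamiltonianMaps α V (φ k) ((E k : ℂ) • φ k)) {j : ι} {ε : ℝ} (hε : 0 < ε)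
    (hgap : ∀ k, E k ≠ E j → ε ≤ |E k - E j|) (a : Fin d) :
    HasSum (fun k => (E k - E j)⁻¹ * ‖(inner ℂ (φ k) (weakPartial a (φ j)) : ℂ)‖ ^ 2)
      (1 / (4 * α)) := by
  have hc : ∀ k, |(E k - E j)⁻¹| ≤ ε⁻¹ := by
    intro k
    by_cases h : E k = E j
    · simp [h, hε.le]
    · rw [abs_inv]
      exact inv_anti₀ hε (hgap k h)
  have hs : ∀ s : ℝ, s ≠ 0 →
      ∑' k, (E k - E j)⁻¹ * ‖(inner ℂ (φ k) (modulationDefect α a s (φ j)) : ℂ)‖ ^ 2 = α := by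
    intro s hs
    have h1 := φ.hasSum_inner_mul_inner (modulate a s (φ j)) (modulationDefect α a s (φ j))
    have h2 : (inner ℂ (modulate a s (φ j)) (modulationDefect α a s (φ j)) : ℂ) =
        ((s * α : ℝ) : ℂ) := by
      rw [modulationDefect, inner_add_right, inner_smul_right, inner_smul_right,
        inner_modulate_modulate, inner_modulate_modulate,
        inner_weakPartial_eq_zero hα (hE j) (hE j) a, inner_self_eq_norm_sq_to_K,
        φ.orthonormal.1 j]
      push_cast
      simp
      ring
    -- the summands of the Parseval identity for `⟨Uₛ φ_j, yₛ⟩ = s * α`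
    have h3 : ∀ k, (inner ℂ (modulate a s (φ j)) (φ k) : ℂ) *
        inner ℂ (φ k) (modulationDefect α a s (φ j)) = ((s * ((E k - E j)⁻¹ *
          ‖(inner ℂ (φ k) (modulationDefect α a s (φ j)) : ℂ)‖ ^ 2) : ℝ) : ℂ) := by
      intro k
      have h4 := sub_mul_inner_modulate (hE j) (hE k) a s
      by_cases h : E k = E j
      · have h5 : (inner ℂ (φ k) (modulationDefect α a s (φ j)) : ℂ) = 0 := by
          simpa [h, hs] using h4
        simp [h5]
      · have h5 : ((E k - E j : ℝ) : ℂ) ≠ 0 := by exact_mod_cast sub_ne_zero.mpr h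
        have h6 : (inner ℂ (φ k) (modulate a s (φ j)) : ℂ) = ((E k - E j : ℝ) : ℂ)⁻¹ *
            (s * inner ℂ (φ k) (modulationDefect α a s (φ j))) := by
          rw [← h4, inv_mul_cancel_left₀ h5]
        rw [← inner_conj_symm, h6]
        simp only [map_mul, map_inv₀, Complex.conj_ofReal]
        push_cast
        rw [← Complex.conj_mul']
        ring
    simp only [h3, h2] at h1
    have h7 := (Complex.hasSum_ofReal.mp h1).tsum_eq
    rw [tsum_mul_left] at h7
    exact mul_left_cancel₀ hs h7
  -- the identity for `s ≠ 0` passes to the limit `s → 0`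
  have hlim := ((continuous_tsum_mul_norm_inner_sq φ.orthonormal hc).tendsto _).comp
    (tendsto_modulationDefect α a (φ j))
  have heq : ∑' k, (E k - E j)⁻¹ *
      ‖(inner ℂ (φ k) ((-(2 * Complex.I * α)) • weakPartial a (φ j)) : ℂ)‖ ^ 2 = α := by
    refine tendsto_nhds_unique_of_eventuallyEq hlim tendsto_const_nhds ?_
    filter_upwards [self_mem_nhdsWithin] with s h0 using hs s h0
  have hval : ∑' k, (E k - E j)⁻¹ * ‖(inner ℂ (φ k) (weakPartial a (φ j)) : ℂ)‖ ^ 2 =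
      1 / (4 * α) := by
    have h1 : ∀ k, (E k - E j)⁻¹ *
        ‖(inner ℂ (φ k) ((-(2 * Complex.I * α)) • weakPartial a (φ j)) : ℂ)‖ ^ 2 =
        (4 * α ^ 2) * ((E k - E j)⁻¹ * ‖(inner ℂ (φ k) (weakPartial a (φ j)) : ℂ)‖ ^ 2) := by
      intro k
      rw [inner_smul_right]
      simp [abs_of_pos hα]
      ring
    simp only [h1, tsum_mul_left] at heq
    field_simp
    field_simp at heq
    linarith
  exact hval ▸ (summable_mul_norm_inner_sq φ.orthonormal hc _).hasSum

end SumRule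

/-! ### Kinetic matrix elements and the spectrum -/

theorem kineticElement_eq (u v : L2 d) :
    kineticElement u v = ∑ a, ‖(inner ℂ (weakPartial a v) u : ℂ)‖ ^ 2 := by
  unfold kineticElement
  refine Finset.sum_congr rfl fun a _ => ?_
  rw [L2.inner_def]
  simp [RCLike.inner_apply]

theorem kineticElement_comm {u v : L2 d} (hu : MemH1 u) (hv : MemH1 v) :
    kineticElement u v = kineticElement v u := by
  rw [kineticElement_eq, kineticElement_eq]
  refine Finset.sum_congr rfl fun a _ => ?_
  rw [(hasWeakPartial_weakPartial hu).inner_left_eq_neg (hasWeakPartial_weakPartial hv), norm_neg,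
    norm_inner_symm]

/-- An eigenvalue lies in the spectrum: a resolvent at `z` would send `0` to the eigenvector. -/
theorem mem_spectrum_of_eigenvector {α : ℝ} {V : EuclideanSpace ℝ (Fin d) → ℝ} {u : L2 d} {z : ℂ}
    (hu : HamiltonianMaps α V u (z • u)) (h0 : u ≠ 0) : z ∈ spectrum α V := by
  rintro ⟨R, hR⟩
  refine h0 ?_
  rw [← (hR u 0).mpr (by rwa [zero_add]), map_zero]

/-! ### From the sum rule to the trace formula -/

/-- Soft thresholding at level `c`, which for `c ≥ 0` moves every real number towards `0` by `c`,
stopping at `0`. -/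
noncomputable def softThreshold (c x : ℝ) : ℝ := max (x - c) 0 - max (-x - c) 0

theorem softThreshold_zero_left (x : ℝ) : softThreshold 0 x = x := by
  unfold softThreshold
  rcases le_total 0 x with h | h <;> simp [h]

theorem softThreshold_of_abs_le {c x : ℝ} (h : |x| ≤ c) : softThreshold c x = 0 := by
  have := abs_le.mp h
  rw [softThreshold, max_eq_right (by linarith), max_eq_right (by linarith), sub_zero]

theorem continuous_softThreshold_left (x : ℝ) : Continuous fun c => softThreshold c x := by
  unfold softThreshold; fun_prop

theorem abs_softThreshold_sub_le {c : ℝ} (hc : 0 ≤ c) (x y : ℝ) :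
    |softThreshold c x - softThreshold c y| ≤ |x - y| := by
  unfold softThreshold
  grind

theorem abs_softThreshold_le {c : ℝ} (hc : 0 ≤ c) (x : ℝ) : |softThreshold c x| ≤ |x| := by
  have h := abs_softThreshold_sub_le hc x 0
  rwa [softThreshold_of_abs_le (x := 0) (by simpa), sub_zero, sub_zero] at h

variable {ι : Type*} {T : ι → ι → ℝ} {E : ι → ℝ} {κ : ℝ}

/-- If `h` has finite support, the double sum of difference quotients may be split into the parts
with `h j` and with `h k`, each of which is a finite combination of sum rules. -/
theorem hasSum_mul_slope_of_finite_support (hsymm : ∀ j k, T j k = T k j)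
    (hrule : ∀ j, HasSum (fun k => T j k * (E k - E j)⁻¹) κ) {h : ι → ℝ}
    (hh : (Function.support h).Finite) :
    HasSum (fun p : ι × ι => T p.1 p.2 * ((h p.1 - h p.2) * (E p.1 - E p.2)⁻¹))
      (-2 * κ * ∑' j, h j) := by
  classical
  set G : ι × ι → ℝ := fun p => h p.1 * (T p.1 p.2 * (E p.2 - E p.1)⁻¹) with hG
  have hrow : ∀ i, HasSum (fun p : ι × ι => if p.1 = i then G p else 0) (h i * κ) := by
    intro i
    have hinj : Function.Injective (fun k : ι => (i, k)) := fun _ _ hk => (Prod.mk.inj hk).2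
    rw [← hinj.hasSum_iff]
    · simpa [Function.comp_def, hG] using (hrule i).mul_left (h i)
    · rintro ⟨j, k⟩ hjk
      refine if_neg fun hj => hjk ⟨k, ?_⟩
      rw [show j = i from hj]
  have hGsum : HasSum G (κ * ∑' j, h j) := by
    have h1 := hasSum_sum fun i (_ : i ∈ hh.toFinset) => hrow i
    rw [tsum_eq_sum (s := hh.toFinset) fun b hb => by simpa using hb, Finset.mul_sum]
    convert h1 using 1
    · funext p
      by_cases hp : p.1 ∈ hh.toFinset
      · rw [Finset.sum_ite_eq, if_pos hp]
      · have : h p.1 = 0 := by simpa using hp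
        simp [hG, this]
    · simp [mul_comm]
  have h2 := (hGsum.add ((Equiv.prodComm ι ι).hasSum_iff.mpr hGsum)).neg
  rw [show -2 * κ * ∑' j, h j = -(κ * ∑' j, h j + κ * ∑' j, h j) by ring]
  refine (congrArg (fun F : ι × ι → ℝ => HasSum F _) (funext fun p => ?_)).mpr h2
  · simp only [hG, Function.comp_apply, Equiv.prodComm_apply, Prod.fst_swap, Prod.snd_swap]
    rw [hsymm p.2 p.1, ← neg_sub (E p.1) (E p.2), inv_neg]
    ring

/-- The passage from a sum rule for each level to the trace formula. The function `g` plays the role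
of the difference quotients of `h` along `E`; its values where `E` coincides do not matter. -/
theorem tsum_mul_slope_of_sum_rule (hsymm : ∀ j k, T j k = T k j)
    (hdiag : ∀ j k, E j = E k → T j k = 0)
    (hrule : ∀ j, HasSum (fun k => T j k * (E k - E j)⁻¹) κ) {h : ι → ℝ} (hh : Summable h)
    {g : ι × ι → ℝ} (hg : ∀ p, g p * (E p.1 - E p.2) = h p.1 - h p.2)
    (hsum : Summable fun p : ι × ι => T p.1 p.2 * g p) :
    ∑' p : ι × ι, T p.1 p.2 * g p = -2 * κ * ∑' j, h j := by
  have hslope : ∀ p : ι × ι,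
      T p.1 p.2 * g p = T p.1 p.2 * ((h p.1 - h p.2) * (E p.1 - E p.2)⁻¹) := by
    intro p
    by_cases hp : E p.1 = E p.2
    · simp [hdiag _ _ hp]
    · rw [← hg p, mul_inv_cancel_right₀ (sub_ne_zero.mpr hp)]
  have hfin : ∀ c : ℝ, 0 < c → (Function.support fun j => softThreshold c (h j)).Finite := by
    intro c hc
    have h1 : ∀ᶠ j in cofinite, |h j| < c := by
      simpa using (hh.tendsto_cofinite_zero.abs).eventually (gt_mem_nhds (by simpa using hc))
    refine Set.Finite.subset (Filter.eventually_cofinite.mp h1) fun j hj hlt => ?_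
    exact hj (softThreshold_of_abs_le hlt.le)
  have hlim : ∀ x, Tendsto (fun c => softThreshold c x) (𝓝[>] 0) (𝓝 x) := by
    intro x
    simpa [softThreshold_zero_left] using
      ((continuous_softThreshold_left x).tendsto 0).mono_left nhdsWithin_le_nhds
  have hleft : Tendsto (fun c => ∑' p : ι × ι, T p.1 p.2 *
      ((softThreshold c (h p.1) - softThreshold c (h p.2)) * (E p.1 - E p.2)⁻¹)) (𝓝[>] 0)
      (𝓝 (∑' p : ι × ι, T p.1 p.2 * g p)) := by
    simp only [hslope] at hsum ⊢
    refine tendsto_tsum_of_dominated_convergence hsum.norm (fun p => ?_) ?_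
    · exact (((hlim _).sub (hlim _)).mul_const _).const_mul _
    · filter_upwards [self_mem_nhdsWithin] with c hc p
      simp only [norm_mul]
      refine mul_le_mul_of_nonneg_left (mul_le_mul_of_nonneg_right ?_ (norm_nonneg _))
        (norm_nonneg _)
      exact abs_softThreshold_sub_le (le_of_lt hc) _ _
  have hright : Tendsto (fun c => -2 * κ * ∑' j, softThreshold c (h j)) (𝓝[>] 0)
      (𝓝 (-2 * κ * ∑' j, h j)) := by
    refine Tendsto.const_mul _ (tendsto_tsum_of_dominated_convergence hh.norm
      (fun j => hlim (h j)) ?_)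
    filter_upwards [self_mem_nhdsWithin] with c hc j using abs_softThreshold_le (le_of_lt hc) _
  refine tendsto_nhds_unique_of_eventuallyEq hleft hright ?_
  filter_upwards [self_mem_nhdsWithin] with c hc
  exact (hasSum_mul_slope_of_finite_support hsymm hrule (hfin c hc)).tsum_eq

theorem integral_deriv_convexCombo_mul_sub {f : ℝ → ℝ} (hf : ContDiff ℝ 1 f) (x y : ℝ) :
    (∫ s in (0 : ℝ)..1, deriv f (s * x + (1 - s) * y)) * (x - y) = f x - f y := by
  have hd : ∀ s : ℝ, HasDerivAt (fun s => f (s * x + (1 - s) * y))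
      (deriv f (s * x + (1 - s) * y) * (x - y)) s := by
    intro s
    have h1 : HasDerivAt (fun s : ℝ => s * x + (1 - s) * y) (x - y) s := by
      have := ((hasDerivAt_id s).mul_const x).add (((hasDerivAt_id s).const_sub 1).mul_const y)
      refine this.congr_deriv ?_
      ring
    exact HasDerivAt.comp s
      ((hf.differentiable one_ne_zero).differentiableAt.hasDerivAt) h1
  have hcont : Continuous fun s : ℝ => deriv f (s * x + (1 - s) * y) * (x - y) :=
    ((hf.continuous_deriv le_rfl).comp (by fun_prop)).mul continuous_const
  rw [← intervalIntegral.integral_mul_const, intervalIntegral.integral_eq_sub_of_hasDerivAt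
    (fun s _ => hd s) (hcont.intervalIntegrable 0 1)]
  simp

end Schrodinger

theorem mainTheorem4 {d : ℕ} {ι : Type*} (α : ℝ) (hα : 0 < α)
    (V : EuclideanSpace ℝ (Fin d) → ℝ) (hV : AEMeasurable V MeasureTheory.volume)
    (hspec : Schrodinger.HasPurelyDiscreteSpectrum α V)
    (φ : HilbertBasis ι ℂ (Schrodinger.L2 d)) (E : ι → ℝ)
    (hE : ∀ k, Schrodinger.HamiltonianMaps α V (φ k) ((E k : ℂ) • φ k)) :
    (∀ j k, Schrodinger.kineticElement (φ j) (φ k) = Schrodinger.kineticElement (φ k) (φ j)) ∧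
    ∀ f : ℝ → ℝ, ContDiff ℝ 1 f →
      Summable (fun j => f (E j)) →
      Summable (fun p : ι × ι => Schrodinger.kineticElement (φ p.1) (φ p.2) *
        ∫ s in (0 : ℝ)..1, deriv f (s * E p.1 + (1 - s) * E p.2)) →
      (d : ℝ) * ∑' j, f (E j) +
        2 * α * ∑' j, ∑' k, Schrodinger.kineticElement (φ j) (φ k) *
          ∫ s in (0 : ℝ)..1, deriv f (s * E j + (1 - s) * E k) = 0 := by
  have hsymm : ∀ j k, Schrodinger.kineticElement (φ j) (φ k) =
      Schrodinger.kineticElement (φ k) (φ j) :=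
    fun j k => Schrodinger.kineticElement_comm (hE j).1.1 (hE k).1.1
  have hgap : ∀ j, ∃ ε > 0, ∀ k, E k ≠ E j → ε ≤ |E k - E j| := by
    intro j
    have hmem : ∀ k, (E k : ℂ) ∈ Schrodinger.spectrum α V := fun k =>
      Schrodinger.mem_spectrum_of_eigenvector (hE k) (φ.orthonormal.ne_zero k)
    obtain ⟨⟨ε, hε, h⟩, -⟩ := hspec _ (hmem j)
    refine ⟨ε, hε, fun k hk => ?_⟩
    have h1 := h _ (hmem k) (by exact_mod_cast hk)
    rwa [Complex.dist_eq, ← Complex.ofReal_sub, Complex.norm_real] at h1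
  have hrule : ∀ j, HasSum
      (fun k => Schrodinger.kineticElement (φ j) (φ k) * (E k - E j)⁻¹) (d * (1 / (4 * α))) := by
    intro j
    obtain ⟨ε, hε, hj⟩ := hgap j
    have h := hasSum_sum fun a (_ : a ∈ Finset.univ) =>
      Schrodinger.hasSum_norm_inner_weakPartial_sq_div hα φ hE hε hj a
    simp only [← Finset.mul_sum, Finset.sum_const, Finset.card_univ, Fintype.card_fin,
      nsmul_eq_mul] at h
    convert h using 2 with k
    rw [hsymm, Schrodinger.kineticElement_eq, mul_comm]
    simp only [norm_inner_symm (φ k)]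
  have hdiag : ∀ j k, E j = E k → Schrodinger.kineticElement (φ j) (φ k) = 0 := by
    intro j k hjk
    have hj := hE j
    rw [hjk] at hj
    rw [Schrodinger.kineticElement_eq]
    refine Finset.sum_eq_zero fun a _ => ?_
    rw [norm_inner_symm, Schrodinger.inner_weakPartial_eq_zero hα (hE k) hj, norm_zero,
      zero_pow two_ne_zero]
  refine ⟨hsymm, fun f hf hsum hsum₂ => ?_⟩
  rw [← hsum₂.tsum_prod, Schrodinger.tsum_mul_slope_of_sum_rule hsymm hdiag hrule hsum
    (fun p => Schrodinger.integral_deriv_convexCombo_mul_sub hf (E p.1) (E p.2)) hsum₂]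
  field_simp
  ring
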